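/- Let $n$ be a natural number and let $\Sigma,\Sigma'\in\mathbb{R}^{n\times n}$ be (symmetric) positive definite matrices. Let $G_\Sigma$ denote the Gaussian distribution on $\mathbb{R}^n$ with zero mean and covariance matrix $\Sigma$. For a permutation $\sigma\in\mathfrak{S}_n$ and $\boldsymbol{x}\in\mathbb{R}^n$ write $\boldsymbol{x}_\sigma=(x_{\sigma(1)},\dots,x_{\sigma(n)})$. Call two matrices $A,B\in\mathbb{R}^{n\times n}$ permutationally similar if $B=PAP^\top$ for some permutation matrix $P$. Then the following statements are equivalent: 1. The distributions $G_\Sigma$ and $G_{\Sigma'}$ are isomorphic, that is, there is $\sigma\in\mathfrak{S}_n$ such that $G_{\Sigma'}$ is the image of $G_\Sigma$ under the coordinate permutation $\boldsymbol{x}\mapsto\boldsymbol{x}_\sigma$. 2. The matrices $\Sigma$ and $\Sigma'$ are permutationally similar. 3. The matrices $\Sigma^{-1}$ and $(\Sigma')^{-1}$ are permutationally similar. 4. For each homogeneous symmetric polynomial $p\in\mathbb{R}[x_1,\dots,x_n]$ of even degree, the expected value of $p(\boldsymbol{x})$ is the same for $G_\Sigma$ and $G_{\Sigma'}$. 5.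 The symmetrized moments of $G_\Sigma$ and $G_{\Sigma'}$ are the same: for every $\boldsymbol{m}=(m_1,\dots,m_n)\in\mathbb{Z}_{\ge 0}^n$, the moments $\mathbb{E}[X_1^{m_1}\cdots X_n^{m_n}]$ under $H_\Sigma$ and under $H_{\Sigma'}$ are equal, where $H_\Sigma$ is the average of the images of $G_\Sigma$ under the $n!$ coordinate permutations $\boldsymbol{x}\mapsto\boldsymbol{x}_\sigma$, $\sigma\in\mathfrak{S}_n$. -/

import Mathlib

open MeasureTheory ProbabilityTheory

noncomputable section

/-- Two square matrices are permutationally similar if `B = P A Pᵀ` for a permutation matrix `P`. -/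
def PermSimilar {n : ℕ} (A B : Matrix (Fin n) (Fin n) ℝ) : Prop :=
  ∃ σ : Equiv.Perm (Fin n), B = σ.permMatrix ℝ * A * (σ.permMatrix ℝ).transpose

/-- The coordinate permutation `x ↦ x_σ = (x_{σ(1)}, …, x_{σ(n)})` of `ℝⁿ`. -/
def permCoords {n : ℕ} (σ : Equiv.Perm (Fin n)) (x : EuclideanSpace ℝ (Fin n)) :
    EuclideanSpace ℝ (Fin n) :=
  WithLp.toLp 2 (fun i => x (σ i))

theorem measurable_permCoords {n : ℕ} (σ : Equiv.Perm (Fin n)) : Measurable (permCoords σ) := by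
  unfold permCoords
  fun_prop

/-- Two distributions on `ℝⁿ` are isomorphic if a coordinate permutation carries one to the
other. -/
def IsomorphicDistributions {n : ℕ} (μ ν : Measure (EuclideanSpace ℝ (Fin n))) : Prop :=
  ∃ σ : Equiv.Perm (Fin n), μ.map (permCoords σ) = ν

/-- The Gaussian distribution on `ℝⁿ` with zero mean and covariance matrix `S`. -/
def centeredGaussian {n : ℕ} (S : Matrix (Fin n) (Fin n) ℝ) :
    Measure (EuclideanSpace ℝ (Fin n)) :=
  multivariateGaussian 0 S

/-- The symmetrization of a distribution on `ℝⁿ`: the average of its images under all `n!`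
coordinate permutations. -/
def symmetrizedDistribution {n : ℕ} (μ : Measure (EuclideanSpace ℝ (Fin n))) :
    Measure (EuclideanSpace ℝ (Fin n)) :=
  (n.factorial : ENNReal)⁻¹ • ∑ σ : Equiv.Perm (Fin n), μ.map (permCoords σ)

/-- The moment `𝔼[X₁^{m₁} ⋯ Xₙ^{mₙ}]` of a distribution on `ℝⁿ`. -/
def mixedMoment {n : ℕ} (μ : Measure (EuclideanSpace ℝ (Fin n))) (m : Fin n → ℕ) : ℝ :=
  ∫ x, ∏ i, x i ^ m i ∂μ

/-- The symmetrized moments of a distribution: the moments of its symmetrization. -/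
def symmetrizedMoment {n : ℕ} (μ : Measure (EuclideanSpace ℝ (Fin n))) (m : Fin n → ℕ) : ℝ :=
  mixedMoment (symmetrizedDistribution μ) m

end

section PermutationSimilarity

open Matrix

variable {n : ℕ}

/-! The substance is that symmetrized moments determine the covariance up to permutation. They fix
the expectation of every polynomial under the symmetrized law. For `⟨t, x⟩ ^ (2k)` this expectation
is a positive constant times the average over `σ` of `(tᵀ S_σ t) ^ k`, where `S_σ` is the permuted
covariance. So for each `t` the power sums of these values agree for `S` and `S'`, and
`exists_eq_of_sum_pow_eq` yields a `σ`, depending on `t`, with `tᵀ S' t = tᵀ S_σ t`. Since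
polynomials form an integral domain, `exists_forall_quadraticForm_eq` makes `σ` independent of `t`.

The rest is formal: symmetric polynomials do not see coordinate permutations, and odd moments vanish
under `x ↦ -x`. -/

theorem permSimilar_iff_exists_submatrix {A B : Matrix (Fin n) (Fin n) ℝ} :
    PermSimilar A B ↔ ∃ σ : Equiv.Perm (Fin n), B = A.submatrix σ σ := by
  refine exists_congr fun σ => ?_
  rw [PEquiv.toMatrix_toPEquiv_mul, Matrix.transpose_permMatrix, PEquiv.mul_toMatrix_toPEquiv]
  rfl

theorem PermSimilar.inv {A B : Matrix (Fin n) (Fin n) ℝ} (h : PermSimilar A B) :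
    PermSimilar A⁻¹ B⁻¹ := by
  obtain ⟨σ, rfl⟩ := permSimilar_iff_exists_submatrix.1 h
  exact permSimilar_iff_exists_submatrix.2 ⟨σ, Matrix.inv_submatrix_equiv A σ σ⟩

theorem permSimilar_inv_iff {A B : Matrix (Fin n) (Fin n) ℝ} (hA : A.PosDef) (hB : B.PosDef) :
    PermSimilar A⁻¹ B⁻¹ ↔ PermSimilar A B := by
  refine ⟨fun h => ?_, PermSimilar.inv⟩
  have h2 := h.inv
  rwa [Matrix.nonsing_inv_nonsing_inv _ (Matrix.isUnit_iff_isUnit_det _ |>.1 hA.isUnit),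
    Matrix.nonsing_inv_nonsing_inv _ (Matrix.isUnit_iff_isUnit_det _ |>.1 hB.isUnit)] at h2

end PermutationSimilarity

/-! ### Permuted Gaussians, integrability, and moments of linear forms. -/

section GaussianMoments

open Matrix

variable {n : ℕ}

instance isGaussian_centeredGaussian (S : Matrix (Fin n) (Fin n) ℝ) :
    IsGaussian (centeredGaussian S) := by
  unfold centeredGaussian
  infer_instance

theorem charFun_centeredGaussian {S : Matrix (Fin n) (Fin n) ℝ} (hS : S.PosSemidef)
    (t : EuclideanSpace ℝ (Fin n)) :
    charFun (centeredGaussian S) t = Complex.exp (-((t ⬝ᵥ S *ᵥ t : ℝ) : ℂ) / 2) := by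
  rw [centeredGaussian, charFun_multivariateGaussian hS]
  simp [neg_div]

theorem inner_permCoords_left (σ : Equiv.Perm (Fin n)) (x t : EuclideanSpace ℝ (Fin n)) :
    inner ℝ (permCoords σ x) t = inner ℝ x (permCoords σ⁻¹ t) := by
  simp only [PiLp.inner_apply, permCoords]
  exact Fintype.sum_equiv σ _ _ fun i => by simp

theorem permCoords_inv_dotProduct_mulVec (S : Matrix (Fin n) (Fin n) ℝ) (σ : Equiv.Perm (Fin n))
    (t : EuclideanSpace ℝ (Fin n)) :
    (permCoords σ⁻¹ t : EuclideanSpace ℝ (Fin n)) ⬝ᵥ S *ᵥ permCoords σ⁻¹ t =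
      t ⬝ᵥ S.submatrix σ σ *ᵥ t := by
  simp only [dotProduct, mulVec, permCoords]
  refine (Fintype.sum_equiv σ _ _ fun i => ?_).symm
  rw [Equiv.Perm.inv_def, Equiv.symm_apply_apply]
  congr 1
  exact Fintype.sum_equiv σ _ _ fun j => by simp

theorem map_permCoords_centeredGaussian {S : Matrix (Fin n) (Fin n) ℝ} (hS : S.PosSemidef)
    (σ : Equiv.Perm (Fin n)) :
    (centeredGaussian S).map (permCoords σ) = centeredGaussian (S.submatrix σ σ) := by
  have : IsProbabilityMeasure ((centeredGaussian S).map (permCoords σ)) :=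
    Measure.isProbabilityMeasure_map (measurable_permCoords σ).aemeasurable
  refine Measure.ext_of_charFun (funext fun t => ?_)
  rw [charFun_centeredGaussian (hS.submatrix σ), charFun_apply,
    integral_map (measurable_permCoords σ).aemeasurable
      (Measurable.aestronglyMeasurable (by fun_prop))]
  simp_rw [inner_permCoords_left]
  rw [← charFun_apply, charFun_centeredGaussian hS, permCoords_inv_dotProduct_mulVec]

theorem map_neg_centeredGaussian {S : Matrix (Fin n) (Fin n) ℝ} (hS : S.PosSemidef) :
    (centeredGaussian S).map (fun x => -x) = centeredGaussian S := by
  refine Measure.ext_of_charFun (funext fun t => ?_)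
  have h := charFun_map_smul (μ := centeredGaussian S) (-1) t
  simp only [neg_smul, one_smul] at h
  rw [h, charFun_centeredGaussian hS, charFun_centeredGaussian hS]
  simp [mulVec_neg]

theorem isomorphicDistributions_centeredGaussian_iff {S S' : Matrix (Fin n) (Fin n) ℝ}
    (hS : S.PosSemidef) (hS' : S'.PosSemidef) :
    IsomorphicDistributions (centeredGaussian S) (centeredGaussian S') ↔ PermSimilar S S' := by
  rw [permSimilar_iff_exists_submatrix]
  refine exists_congr fun σ => ?_
  rw [map_permCoords_centeredGaussian hS]
  refine ⟨fun h => ?_, fun h => h ▸ rfl⟩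
  ext i j
  -- The law determines the matrix, whose entries are the covariances of the coordinates.
  have hc := covariance_eval_multivariateGaussian (μ := 0) hS' i j
  rw [← hc, ← covariance_eval_multivariateGaussian (μ := 0) (hS.submatrix σ) i j]
  exact congrArg (fun μ => cov[fun x => x i, fun x => x j; μ]) h.symm

theorem integrable_prod_pow_of_isGaussian (μ : Measure (EuclideanSpace ℝ (Fin n))) [IsGaussian μ]
    (m : Fin n → ℕ) : Integrable (fun x : EuclideanSpace ℝ (Fin n) => ∏ i, x i ^ m i) μ := by
  -- Since `|x i| ≤ ‖x‖`, the monomial is dominated by `‖x‖` to its total degree.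
  have h := (IsGaussian.memLp_id μ (∑ i, m i : ℕ) (by simp)).integrable_norm_pow'
  refine h.mono' (Measurable.aestronglyMeasurable (by fun_prop)) (.of_forall fun x => ?_)
  rw [norm_prod, ← Finset.prod_pow_eq_pow_sum]
  refine Finset.prod_le_prod (fun _ _ => norm_nonneg _) fun i _ => ?_
  rw [norm_pow]
  exact pow_le_pow_left₀ (norm_nonneg _) (PiLp.norm_apply_le x i) _

theorem integrable_eval_of_isGaussian (μ : Measure (EuclideanSpace ℝ (Fin n))) [IsGaussian μ]
    (p : MvPolynomial (Fin n) ℝ) :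
    Integrable (fun x : EuclideanSpace ℝ (Fin n) => MvPolynomial.eval (fun i => x i) p) μ := by
  simp only [MvPolynomial.eval_eq']
  exact integrable_finsetSum _ fun d _ => (integrable_prod_pow_of_isGaussian μ d).const_mul _

theorem map_inner_centeredGaussian {S : Matrix (Fin n) (Fin n) ℝ} (hS : S.PosSemidef)
    (t : EuclideanSpace ℝ (Fin n)) :
    (centeredGaussian S).map (fun x => inner ℝ t x) =
      gaussianReal 0 (t ⬝ᵥ S *ᵥ t).toNNReal := by
  have h := IsGaussian.map_eq_gaussianReal (μ := centeredGaussian S) (innerSL ℝ t)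
  have hmean : (centeredGaussian S)[innerSL ℝ t] = 0 := by
    rw [ContinuousLinearMap.integral_comp_id_comm IsGaussian.integrable_id, centeredGaussian,
      integral_id_multivariateGaussian, map_zero]
  have hvar : Var[innerSL ℝ t; centeredGaussian S] = t ⬝ᵥ S *ᵥ t := by
    rw [← covarianceBilin_multivariateGaussian (μ := 0) hS, covarianceBilin_self]
    · rfl
    · exact IsGaussian.memLp_two_id
  rw [hmean, hvar] at h
  exact h

/-- The `2k`-th moment of the standard Gaussian distribution on `ℝ`. -/
noncomputable def stdGaussianEvenMoment (k : ℕ) : ℝ := ∫ x, x ^ (2 * k) ∂gaussianReal 0 1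

/-- Positivity allows this factor to be cancelled when the power sums are compared. It holds because
the integrand vanishes at most at `0`, which is not an atom. -/
theorem stdGaussianEvenMoment_pos (k : ℕ) : 0 < stdGaussianEvenMoment k := by
  have hint : Integrable (fun x : ℝ => x ^ (2 * k)) (gaussianReal 0 1) := by
    have h := (memLp_id_gaussianReal' (μ := 0) (v := 1) (2 * k : ℕ)
      (ENNReal.natCast_ne_top _)).integrable_norm_pow'
    simpa [pow_mul] using h
  have := nullSingletonClass_gaussianReal (μ := 0) (v := 1) one_ne_zero
  rw [stdGaussianEvenMoment,
    integral_pos_iff_support_of_nonneg (fun x => (even_two_mul k).pow_nonneg x) hint]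
  have hsub : ({0}ᶜ : Set ℝ) ⊆ Function.support fun x : ℝ => x ^ (2 * k) :=
    fun x hx => pow_ne_zero _ hx
  refine lt_of_lt_of_le ?_ (measure_mono hsub)
  rw [prob_compl_eq_one_sub (measurableSet_singleton 0), measure_singleton]
  simp

theorem integral_pow_gaussianReal_zero (v : NNReal) (k : ℕ) :
    ∫ x, x ^ (2 * k) ∂gaussianReal 0 v = v ^ k * stdGaussianEvenMoment k := by
  have h := gaussianReal_map_const_mul (μ := 0) (v := 1) (NNReal.sqrt v)
  have hv : (NNReal.mk ((NNReal.sqrt v : ℝ) ^ 2) (sq_nonneg _)) * 1 = v := by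
    ext
    simp
  rw [hv, mul_zero] at h
  rw [← h, integral_map (by fun_prop) (by fun_prop)]
  simp_rw [mul_pow]
  rw [integral_const_mul, stdGaussianEvenMoment, pow_mul]
  simp

theorem integral_inner_pow_centeredGaussian {S : Matrix (Fin n) (Fin n) ℝ} (hS : S.PosSemidef)
    (t : EuclideanSpace ℝ (Fin n)) (k : ℕ) :
    ∫ x, (inner ℝ t x) ^ (2 * k) ∂centeredGaussian S =
      (t ⬝ᵥ S *ᵥ t) ^ k * stdGaussianEvenMoment k := by
  have h := integral_map (μ := centeredGaussian S) (φ := fun x => inner ℝ t x)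
    (f := fun y : ℝ => y ^ (2 * k)) (by fun_prop) (by fun_prop)
  have hnn : 0 ≤ t ⬝ᵥ S *ᵥ t := by
    simpa using hS.dotProduct_mulVec_nonneg t
  rw [← h, map_inner_centeredGaussian hS, integral_pow_gaussianReal_zero, Real.coe_toNNReal _ hnn]

end GaussianMoments

/-! ### Symmetrized moments and symmetric polynomials. -/

section SymmetrizedMoments

open Matrix

variable {n : ℕ}

theorem integral_symmetrizedDistribution_centeredGaussian {S : Matrix (Fin n) (Fin n) ℝ}
    (hS : S.PosSemidef) (p : MvPolynomial (Fin n) ℝ) :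
    ∫ x, MvPolynomial.eval (fun i => x i) p ∂symmetrizedDistribution (centeredGaussian S) =
      (n.factorial : ℝ)⁻¹ * ∑ σ : Equiv.Perm (Fin n),
        ∫ x, MvPolynomial.eval (fun i => x i) p ∂centeredGaussian (S.submatrix σ σ) := by
  simp only [symmetrizedDistribution, map_permCoords_centeredGaussian hS]
  rw [integral_smul_measure,
    integral_finsetSum_measure fun σ _ => integrable_eval_of_isGaussian _ p]
  simp

theorem integrable_eval_symmetrizedDistribution {S : Matrix (Fin n) (Fin n) ℝ}
    (hS : S.PosSemidef) (p : MvPolynomial (Fin n) ℝ) :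
    Integrable (fun x : EuclideanSpace ℝ (Fin n) => MvPolynomial.eval (fun i => x i) p)
      (symmetrizedDistribution (centeredGaussian S)) := by
  simp only [symmetrizedDistribution, map_permCoords_centeredGaussian hS]
  refine Integrable.smul_measure ?_ (by simp [Nat.factorial_ne_zero])
  exact integrable_finsetSum_measure.2 fun σ _ => integrable_eval_of_isGaussian _ p

theorem integral_eval_symmetrizedDistribution {S : Matrix (Fin n) (Fin n) ℝ}
    (hS : S.PosSemidef) (p : MvPolynomial (Fin n) ℝ) :
    ∫ x, MvPolynomial.eval (fun i => x i) p ∂symmetrizedDistribution (centeredGaussian S) =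
      ∑ d ∈ p.support, p.coeff d * symmetrizedMoment (centeredGaussian S) d := by
  simp only [MvPolynomial.eval_eq']
  rw [integral_finsetSum]
  · simp only [integral_const_mul]
    rfl
  · intro d _
    have h := integrable_eval_symmetrizedDistribution hS (MvPolynomial.monomial d 1)
    simp only [MvPolynomial.eval_monomial, one_mul] at h
    refine Integrable.const_mul (h.congr (.of_forall fun x => ?_)) _
    exact Finsupp.prod_fintype _ _ (by simp)

/-- The sum of the monomials obtained from `x₁^{m₁} ⋯ xₙ^{mₙ}` by permuting the variables. -/
noncomputable def permSumMonomial (m : Fin n → ℕ) : MvPolynomial (Fin n) ℝ :=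
  ∑ σ : Equiv.Perm (Fin n), ∏ i, MvPolynomial.X (σ i) ^ m i

theorem permSumMonomial_isHomogeneous (m : Fin n → ℕ) :
    (permSumMonomial m).IsHomogeneous (∑ i, m i) := by
  refine MvPolynomial.IsHomogeneous.sum _ _ _ fun σ _ => ?_
  refine MvPolynomial.IsHomogeneous.prod _ _ _ fun i _ => ?_
  simpa using (MvPolynomial.isHomogeneous_X ℝ (σ i)).pow (m i)

theorem permSumMonomial_isSymmetric (m : Fin n → ℕ) : (permSumMonomial m).IsSymmetric := by
  intro τ
  simp only [permSumMonomial, map_sum, map_prod, map_pow, MvPolynomial.rename_X]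
  exact Fintype.sum_equiv (Equiv.mulLeft τ) _ _ fun σ => rfl

/-- The averaging moves from the measure to the monomial, which turns a symmetrized moment into the
expectation of a symmetric homogeneous polynomial. -/
theorem symmetrizedMoment_centeredGaussian {S : Matrix (Fin n) (Fin n) ℝ} (hS : S.PosSemidef)
    (m : Fin n → ℕ) :
    symmetrizedMoment (centeredGaussian S) m = (n.factorial : ℝ)⁻¹ *
      ∫ x, MvPolynomial.eval (fun i => x i) (permSumMonomial m) ∂centeredGaussian S := by
  have h := integral_symmetrizedDistribution_centeredGaussian hS
    (∏ i, MvPolynomial.X i ^ m i)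
  simp only [map_prod, map_pow, MvPolynomial.eval_X] at h
  rw [symmetrizedMoment, mixedMoment, h]
  simp only [permSumMonomial, map_sum, map_prod, map_pow, MvPolynomial.eval_X]
  rw [integral_finsetSum]
  · congr 1
    refine Finset.sum_congr rfl fun σ _ => ?_
    rw [← map_permCoords_centeredGaussian hS, integral_map
      (measurable_permCoords σ).aemeasurable (Measurable.aestronglyMeasurable (by fun_prop))]
    rfl
  · intro σ _
    have h := integrable_eval_of_isGaussian (centeredGaussian S)
      (∏ i, MvPolynomial.X (σ i) ^ m i)
    simpa only [map_prod, map_pow, MvPolynomial.eval_X] using h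

theorem eval_neg_of_isHomogeneous_odd {p : MvPolynomial (Fin n) ℝ} {k : ℕ}
    (hp : p.IsHomogeneous k) (hk : Odd k) (x : Fin n → ℝ) :
    MvPolynomial.eval (fun i => -x i) p = -MvPolynomial.eval x p := by
  simp only [MvPolynomial.eval_eq']
  rw [← Finset.sum_neg_distrib]
  refine Finset.sum_congr rfl fun d hd => ?_
  have hdeg : ∑ i, d i = k := by
    have := hp (MvPolynomial.mem_support_iff.1 hd)
    simpa [Finsupp.weight_apply, Finsupp.sum_fintype] using this
  have hprod : ∏ i, (-x i) ^ d i = (-1) ^ (∑ i, d i) * ∏ i, x i ^ d i := by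
    rw [← Finset.prod_pow_eq_pow_sum, ← Finset.prod_mul_distrib]
    exact Finset.prod_congr rfl fun i _ => neg_pow _ _
  rw [hprod, hdeg, hk.neg_one_pow]
  ring

theorem integral_eval_eq_zero_of_odd {S : Matrix (Fin n) (Fin n) ℝ} (hS : S.PosSemidef)
    {p : MvPolynomial (Fin n) ℝ} {k : ℕ} (hp : p.IsHomogeneous k) (hk : Odd k) :
    ∫ x, MvPolynomial.eval (fun i => x i) p ∂centeredGaussian S = 0 := by
  have h : ∫ x, MvPolynomial.eval (fun i => x i) p ∂centeredGaussian S =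
      ∫ x, -MvPolynomial.eval (fun i => x i) p ∂centeredGaussian S := by
    conv_lhs => rw [← map_neg_centeredGaussian hS]
    rw [integral_map (by fun_prop)
      (integrable_eval_of_isGaussian _ p).aestronglyMeasurable]
    refine integral_congr_ae (.of_forall fun x => ?_)
    exact eval_neg_of_isHomogeneous_odd hp hk x
  rw [integral_neg] at h
  linarith

theorem integral_eval_eq_of_isomorphic {μ ν : Measure (EuclideanSpace ℝ (Fin n))} [IsGaussian ν]
    (h : IsomorphicDistributions μ ν) {p : MvPolynomial (Fin n) ℝ} (hp : p.IsSymmetric) :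
    ∫ x, MvPolynomial.eval (fun i => x i) p ∂μ = ∫ x, MvPolynomial.eval (fun i => x i) p ∂ν := by
  obtain ⟨σ, rfl⟩ := h
  rw [integral_map (measurable_permCoords σ).aemeasurable
    (integrable_eval_of_isGaussian _ p).aestronglyMeasurable]
  refine integral_congr_ae (.of_forall fun x => ?_)
  conv_lhs => rw [← hp σ]
  exact MvPolynomial.eval_rename _ _ _

/-! ### Recovering the covariance matrix from power sums. -/

theorem exists_eq_of_sum_pow_eq {ι : Type*} [Fintype ι] {a b : ι → ℝ}
    (h : ∀ k : ℕ, ∑ i, a i ^ k = ∑ i, b i ^ k) (j : ι) : ∃ i, b j = a i := by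
  have heval (f : Polynomial ℝ) : ∑ i, f.eval (a i) = ∑ i, f.eval (b i) := by
    simp only [Polynomial.eval_eq_sum_range]
    rw [Finset.sum_comm, Finset.sum_comm (s := Finset.univ)]
    simp only [← Finset.mul_sum, h]
  -- This polynomial is nonnegative and its real zeros are exactly the `a i`. Its sum over `a` is
  -- zero, so it vanishes at every `b j`.
  have hf := heval (∏ i, (Polynomial.X - Polynomial.C (a i)) ^ 2)
  simp only [Polynomial.eval_prod, Polynomial.eval_pow, Polynomial.eval_sub, Polynomial.eval_X,
    Polynomial.eval_C] at hf
  rw [Finset.sum_eq_zero fun i _ => Finset.prod_eq_zero (Finset.mem_univ i) (by simp)] at hf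
  have hj := (Finset.sum_eq_zero_iff_of_nonneg
    fun i _ => Finset.prod_nonneg fun l _ => sq_nonneg (b i - a l)).1 hf.symm j (Finset.mem_univ j)
  obtain ⟨i, -, hi⟩ := Finset.prod_eq_zero_iff.1 hj
  exact ⟨i, sub_eq_zero.1 (pow_eq_zero_iff two_ne_zero |>.1 hi)⟩

theorem sum_quadraticForm_pow_eq {S S' : Matrix (Fin n) (Fin n) ℝ} (hS : S.PosSemidef)
    (hS' : S'.PosSemidef)
    (h : ∀ m, symmetrizedMoment (centeredGaussian S) m = symmetrizedMoment (centeredGaussian S') m)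
    (t : EuclideanSpace ℝ (Fin n)) (k : ℕ) :
    ∑ σ : Equiv.Perm (Fin n), (t ⬝ᵥ S.submatrix σ σ *ᵥ t) ^ k =
      ∑ σ : Equiv.Perm (Fin n), (t ⬝ᵥ S'.submatrix σ σ *ᵥ t) ^ k := by
  set p : MvPolynomial (Fin n) ℝ :=
    (∑ i, MvPolynomial.C (t i) * MvPolynomial.X i) ^ (2 * k) with hp
  have heval (x : EuclideanSpace ℝ (Fin n)) :
      MvPolynomial.eval (fun i => x i) p = inner ℝ t x ^ (2 * k) := by
    simp [hp, PiLp.inner_apply, mul_comm]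
  have key {T : Matrix (Fin n) (Fin n) ℝ} (hT : T.PosSemidef) :
      ∫ x, MvPolynomial.eval (fun i => x i) p ∂symmetrizedDistribution (centeredGaussian T) =
        (n.factorial : ℝ)⁻¹ * ((∑ σ : Equiv.Perm (Fin n), (t ⬝ᵥ T.submatrix σ σ *ᵥ t) ^ k) *
          stdGaussianEvenMoment k) := by
    rw [integral_symmetrizedDistribution_centeredGaussian hT, Finset.sum_mul]
    simp only [heval, integral_inner_pow_centeredGaussian (hT.submatrix _)]
  have heq := (integral_eval_symmetrizedDistribution hS p).trans
    ((Finset.sum_congr rfl fun d _ => by rw [h]).trans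
      (integral_eval_symmetrizedDistribution hS' p).symm)
  rw [key hS, key hS'] at heq
  have hn : (n.factorial : ℝ)⁻¹ ≠ 0 := by positivity
  exact mul_right_cancel₀ (stdGaussianEvenMoment_pos k).ne' (mul_left_cancel₀ hn heq)

/-- The quadratic form of a matrix as a polynomial. -/
noncomputable def quadraticPolynomial (A : Matrix (Fin n) (Fin n) ℝ) : MvPolynomial (Fin n) ℝ :=
  (fun i => MvPolynomial.X i) ⬝ᵥ A.map MvPolynomial.C *ᵥ fun i => MvPolynomial.X i

theorem eval_quadraticPolynomial (A : Matrix (Fin n) (Fin n) ℝ) (t : Fin n → ℝ) :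
    MvPolynomial.eval t (quadraticPolynomial A) = t ⬝ᵥ A *ᵥ t := by
  simp [quadraticPolynomial, dotProduct, mulVec]

theorem exists_forall_quadraticForm_eq {ι : Type*} [Fintype ι] (A : ι → Matrix (Fin n) (Fin n) ℝ)
    (B : Matrix (Fin n) (Fin n) ℝ) (h : ∀ t : Fin n → ℝ, ∃ i, t ⬝ᵥ B *ᵥ t = t ⬝ᵥ A i *ᵥ t) :
    ∃ i, ∀ t : Fin n → ℝ, t ⬝ᵥ B *ᵥ t = t ⬝ᵥ A i *ᵥ t := by
  -- At each point some factor vanishes, so the product is the zero polynomial, and hence one factor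
  -- is zero identically.
  have hprod : ∏ i, (quadraticPolynomial B - quadraticPolynomial (A i)) = 0 := by
    refine MvPolynomial.funext fun t => ?_
    obtain ⟨i, hi⟩ := h t
    rw [map_prod, map_zero]
    refine Finset.prod_eq_zero (Finset.mem_univ i) ?_
    rw [map_sub, eval_quadraticPolynomial, eval_quadraticPolynomial, hi, sub_self]
  obtain ⟨i, -, hi⟩ := Finset.prod_eq_zero_iff.1 hprod
  refine ⟨i, fun t => ?_⟩
  rw [← eval_quadraticPolynomial, ← eval_quadraticPolynomial, sub_eq_zero.1 hi]

theorem isomorphicDistributions_of_symmetrizedMoment_eq {S S' : Matrix (Fin n) (Fin n) ℝ}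
    (hS : S.PosSemidef) (hS' : S'.PosSemidef)
    (h : ∀ m, symmetrizedMoment (centeredGaussian S) m =
      symmetrizedMoment (centeredGaussian S') m) :
    IsomorphicDistributions (centeredGaussian S) (centeredGaussian S') := by
  obtain ⟨σ, hσ⟩ := exists_forall_quadraticForm_eq
    (fun σ : Equiv.Perm (Fin n) => S.submatrix σ σ) S' fun t =>
      exists_eq_of_sum_pow_eq
        (b := fun σ : Equiv.Perm (Fin n) => t ⬝ᵥ S'.submatrix σ σ *ᵥ t)
        -- The index `1` is the identity permutation, which selects the form of `S'` itself.
        (sum_quadraticForm_pow_eq hS hS' h (WithLp.toLp 2 t)) 1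
  refine ⟨σ, ?_⟩
  rw [map_permCoords_centeredGaussian hS]
  -- The characteristic function depends only on the quadratic form, so the matrices need not be
  -- compared entrywise.
  refine Measure.ext_of_charFun (funext fun t => ?_)
  rw [charFun_centeredGaussian (hS.submatrix σ), charFun_centeredGaussian hS', hσ]

end SymmetrizedMoments

theorem mainTheorem3 (n : ℕ) (S S' : Matrix (Fin n) (Fin n) ℝ) (hS : S.PosDef) (hS' : S'.PosDef) :
    List.TFAE [
      IsomorphicDistributions (centeredGaussian S) (centeredGaussian S'),
      PermSimilar S S',
      PermSimilar S⁻¹ S'⁻¹,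
      ∀ (k : ℕ) (p : MvPolynomial (Fin n) ℝ), Even k → p.IsHomogeneous k → p.IsSymmetric →
        ∫ x, MvPolynomial.eval (fun i => x i) p ∂(centeredGaussian S) =
          ∫ x, MvPolynomial.eval (fun i => x i) p ∂(centeredGaussian S'),
      ∀ m : Fin n → ℕ,
        symmetrizedMoment (centeredGaussian S) m = symmetrizedMoment (centeredGaussian S') m] := by
  have hP := hS.posSemidef
  have hP' := hS'.posSemidef
  tfae_have 1 ↔ 2 := isomorphicDistributions_centeredGaussian_iff hP hP'
  tfae_have 3 ↔ 2 := permSimilar_inv_iff hS hS'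
  tfae_have 1 → 4 := fun h _ _ _ _ hp => integral_eval_eq_of_isomorphic h hp
  tfae_have 4 → 5 := by
    intro h m
    rw [symmetrizedMoment_centeredGaussian hP, symmetrizedMoment_centeredGaussian hP']
    congr 1
    rcases Nat.even_or_odd (∑ i, m i) with hm | hm
    · exact h _ _ hm (permSumMonomial_isHomogeneous m) (permSumMonomial_isSymmetric m)
    · rw [integral_eval_eq_zero_of_odd hP (permSumMonomial_isHomogeneous m) hm,
        integral_eval_eq_zero_of_odd hP' (permSumMonomial_isHomogeneous m) hm]
  tfae_have 5 → 1 := isomorphicDistributions_of_symmetrizedMoment_eq hP hP'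
  tfae_finish
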